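/- Conventions. $\mathbf{Comp}$ denotes the class of compact Hausdorff spaces. A cover of $X\in\mathbf{Comp}$ is a pair $(Y,f)$ with $Y\in\mathbf{Comp}$ and $f:Y\to X$ a continuous surjection that is perfect (closed, with compact fibres) and irreducible ($f(F)\neq X$ for every proper closed $F\subsetneq Y$). A covering operator $c$ assigns to each $X\in\mathbf{Comp}$ a cover $(cX,c_X)$ of $X$ such that $cX\in\mathrm{fix}(c):=\{Z : c_Z \text{ is a homeomorphism}\}$ and, for every cover $(Y,f)$ of $X$ with $Y\in\mathrm{fix}(c)$, there is a continuous $g:Y\to cX$ with $f=c_X\circ g$. For $K\in\mathbf{Comp}$, let $\mathcal S(K,c)$ consist of the pairs $(X,f)$ with $X\in\mathbf{Comp}$ and $f:K\to X$ continuous such that $c_X\circ h=f$ for some homeomorphism $h:K\to cX$; put $(X_1,f_1)\le(X_2,f_2)$ if $f_1=g\circ f_2$ for some continuous $g:X_2\to X_1$. $\mathbf W^*$ denotes the class of Archimedean real vector lattices $A$ with a distinguished strong unit $u_A\ge 0$ (every $|a|$ is below some $n u_A$); morphisms are the linear lattice homomorphisms that preserve the distinguished units. An essential embedding is an injective morphism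 $f:A\to B$ such that every morphism $f_1:B\to C$ with $f_1\circ f$ injective is itself injective. $YA$ is the set of ideals $P$ of $A$ that are maximal with respect to $u_A\notin P$, with the hull-kernel topology (a compact Hausdorff space); $\nu_A:A\to C(YA)$ is the morphism for which $\nu_A(a)(P)$ is the unique real $r$ with $a-ru_A\in P$; and for a morphism $\varphi:A\to B$, $Y\varphi:YB\to YA$ is $Q\mapsto\varphi^{-1}(Q)$. For $X\in\mathbf{Comp}$, $C(X)\in\mathbf W^*$ has unit $1$, and $F(X)=\{f\in C(X): f(X)\text{ is finite}\}$. For a covering operator $c$ put $\mu(c)A=C(cYA)$ and $\mu(c)_A:A\to\mu(c)A$, $a\mapsto\nu_A(a)\circ c_{YA}$. For $H\in\mathbf W^*$, let $\mathcal V(H,\mu(c))$ consist of the pairs $(A,\varphi)$ with $A\in\mathbf W^*$ and $\varphi:A\to H$ a morphism such that $e\circ\varphi=\mu(c)_A$ for some isomorphism $e:H\to\mu(c)A$; put $(A_1,\varphi_1)\le(A_2,\varphi_2)$ if $\varphi_1=\varphi_2\circ f$ for some essential embedding $f:A_1\to A_2$. A minimum of $\mathcal S(K,c)$ or of $\mathcal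 V(H,\mu(c))$ is a member that is $\le$ every member. Theorem. Let $c$ be a covering operator, let $H\in\mathbf W^*$ satisfy $\mu(c)H=H$ (that is, $\mu(c)_H$ is an isomorphism), and let $M\in\mathbf W^*$. (1) For every morphism $\varphi:M\to H$, the pair $(M,\varphi)$ is the minimum of $\mathcal V(H,\mu(c))$ if and only if $(YM,Y\varphi)$ is the minimum of $\mathcal S(YH,c)$, $YM$ is zero-dimensional (its clopen sets form a base), and $M=F(YM)$, i.e. $\nu_M(M)=F(YM)$. (2) Consequently, without naming the structure maps: $(M,\varphi)$ is the minimum of $\mathcal V(H,\mu(c))$ for some morphism $\varphi:M\to H$ if and only if $(YM,f)$ is the minimum of $\mathcal S(YH,c)$ for some continuous $f:YH\to YM$, $YM$ is zero-dimensional, and $\nu_M(M)=F(YM)$. -/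

import Mathlib

universe u v

/-! ## Covers and covering operators on compact Hausdorff spaces -/

/-- `f : Y → X` is a covering map: a perfect (closed with compact fibres) irreducible continuous
surjection. -/
structure IsCover {X : Type u} {Y : Type v} [TopologicalSpace X] [TopologicalSpace Y]
    (f : C(Y, X)) : Prop where
  surjective : Function.Surjective f
  isClosedMap : IsClosedMap f
  isCompact_fiber : ∀ x : X, IsCompact (f ⁻¹' {x})
  irreducible : ∀ F : Set Y, IsClosed F → F ≠ Set.univ → f '' F ≠ Set.univ

/-- A function assigning to each compact Hausdorff space `X` a cover `(cX, c_X)` of `X`. -/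
structure CoverAssignment where
  obj : CompHaus.{u} → CompHaus.{u}
  map : ∀ X : CompHaus.{u}, C(obj X, X)
  isCover : ∀ X : CompHaus.{u}, IsCover (map X)

/-- The class of spaces `X` for which `c_X` is a homeomorphism. -/
def CoverAssignment.fix (c : CoverAssignment.{u}) : Set CompHaus.{u} :=
  {X | IsHomeomorph (c.map X)}

/-- A covering operator: `(cX, c_X)` is the minimum among the covers `(Y, f)` of `X` with
`Y ∈ fix c`, where `(Y₁, f₁) ≤ (Y₂, f₂)` means that `f₂ = f₁ ∘ g` for a continuous `g : Y₂ → Y₁`. -/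
structure CoveringOperator extends CoverAssignment.{u} where
  obj_mem_fix : ∀ X : CompHaus.{u}, obj X ∈ toCoverAssignment.fix
  obj_le : ∀ (X Y : CompHaus.{u}) (f : C(Y, X)), IsCover f → Y ∈ toCoverAssignment.fix →
    ∃ g : C(Y, obj X), f = (map X).comp g

/-- The pair `(X, f)`, `f : K → X`, belongs to `{X : cX = K}`: the pairs `(K, f)` and `(cX, c_X)`
are equivalent covers of `X`. -/
def CoveringOperator.MemS (c : CoveringOperator.{u}) (K X : CompHaus.{u}) (f : C(K, X)) : Prop :=
  ∃ h : K ≃ₜ c.obj X, ∀ k : K, c.map X (h k) = f k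

/-- The pair `(X, f)` is the minimum of `{X : cX = K}`, where `(X₁, f₁) ≤ (X₂, f₂)` means that
`f₁ = g ∘ f₂` for a continuous `g : X₂ → X₁`. -/
def CoveringOperator.IsMinimumS (c : CoveringOperator.{u}) (K X : CompHaus.{u}) (f : C(K, X)) :
    Prop :=
  c.MemS K X f ∧ ∀ (X' : CompHaus.{u}) (f' : C(K, X')), c.MemS K X' f' →
    ∃ g : C(X', X), f = g.comp f'

/-- A space is zero-dimensional if its clopen sets form a base of the topology. -/
def IsZeroDimensional (X : Type u) [TopologicalSpace X] : Prop :=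
  TopologicalSpace.IsTopologicalBasis {U : Set X | IsClopen U}

/-! ## Archimedean vector lattices with distinguished strong unit -/

/-- An Archimedean real vector lattice with a distinguished strong unit. -/
structure WStar : Type (u + 1) where
  carrier : Type u
  [addCommGroup : AddCommGroup carrier]
  [lattice : Lattice carrier]
  [isOrderedAddMonoid : IsOrderedAddMonoid carrier]
  [module : Module ℝ carrier]
  [isOrderedModule : IsOrderedModule ℝ carrier]
  archimedean : ∀ a b : carrier, (∀ n : ℕ, n • a ≤ b) → a ≤ 0
  unit : carrier
  unit_nonneg : 0 ≤ unit
  exists_abs_le : ∀ a : carrier, ∃ n : ℕ, |a| ≤ n • unit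

namespace WStar

instance : CoeSort WStar.{u} (Type u) := ⟨WStar.carrier⟩

attribute [instance] WStar.addCommGroup WStar.lattice WStar.isOrderedAddMonoid WStar.module
  WStar.isOrderedModule

/-- A morphism: a linear lattice homomorphism preserving the distinguished units. -/
@[ext]
structure Hom (A : WStar.{u}) (B : WStar.{v}) where
  toLin : A →ₗ[ℝ] B
  map_sup' : ∀ a b : A, toLin (a ⊔ b) = toLin a ⊔ toLin b
  map_inf' : ∀ a b : A, toLin (a ⊓ b) = toLin a ⊓ toLin b
  map_unit' : toLin A.unit = B.unit

instance (A : WStar.{u}) (B : WStar.{v}) : CoeFun (Hom A B) (fun _ => A → B) :=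
  ⟨fun f => f.toLin⟩

/-- The identity morphism. -/
def Hom.id (A : WStar.{u}) : Hom A A where
  toLin := LinearMap.id
  map_sup' _ _ := rfl
  map_inf' _ _ := rfl
  map_unit' := rfl

/-- Composition of morphisms, `g.comp f = g ∘ f`. -/
def Hom.comp {A B C : WStar.{u}} (g : Hom B C) (f : Hom A B) : Hom A C where
  toLin := g.toLin.comp f.toLin
  map_sup' a b := by simp [f.map_sup', g.map_sup']
  map_inf' a b := by simp [f.map_inf', g.map_inf']
  map_unit' := by simp [f.map_unit', g.map_unit']

/-- Isomorphisms. -/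
def Hom.IsIso {A B : WStar.{u}} (f : Hom A B) : Prop :=
  ∃ g : Hom B A, g.comp f = Hom.id A ∧ f.comp g = Hom.id B

/-- `f : A → B` is an essential embedding: it is injective, and any morphism `f₁ : B → C` with
`f₁ ∘ f` injective is injective. -/
def Hom.IsEssentialEmbedding {A B : WStar.{u}} (f : Hom A B) : Prop :=
  Function.Injective f ∧
    ∀ (C : WStar.{u}) (f₁ : Hom B C), Function.Injective (f₁.comp f) → Function.Injective f₁

/-- The vector lattice `C(X)` of continuous real functions on a compact Hausdorff space, with
the constant function `1` as strong unit. -/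
def ofCompHaus (X : CompHaus.{u}) : WStar.{u} where
  carrier := C(X, ℝ)
  isOrderedModule :=
    { smul_le_smul_of_nonneg_left := fun r hr f g hfg x =>
        mul_le_mul_of_nonneg_left (hfg x) hr
      smul_le_smul_of_nonneg_right := fun f hf r s hrs x =>
        mul_le_mul_of_nonneg_right hrs (hf x) }
  archimedean f g h x := by
    by_contra hx
    have hx' : 0 < f x := not_le.mp hx
    obtain ⟨n, hn⟩ := exists_lt_nsmul hx' (g x)
    exact absurd (h n x) (not_le.mpr hn)
  unit := 1
  unit_nonneg _ := zero_le_one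
  exists_abs_le f := by
    obtain ⟨n, hn⟩ := exists_nat_ge ‖f‖
    refine ⟨n, fun x => ?_⟩
    have h := f.norm_coe_le_norm x
    rw [Real.norm_eq_abs] at h
    simpa using h.trans hn

/-- The morphism `C(X) → C(Y)`, `f ↦ f ∘ τ`, induced by a continuous map `τ : Y → X`. -/
def pullback {X Y : CompHaus.{u}} (τ : C(Y, X)) : Hom (ofCompHaus X) (ofCompHaus Y) where
  toLin :=
    { toFun := fun f : C(X, ℝ) => (f.comp τ : C(Y, ℝ))
      map_add' := fun _ _ => rfl
      map_smul' := fun _ _ => rfl }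
  map_sup' _ _ := rfl
  map_inf' _ _ := rfl
  map_unit' := rfl

/-! ## The Yosida space -/

/-- A (vector lattice) ideal: a solid linear subspace. -/
def IsIdeal (A : WStar.{u}) (P : Submodule ℝ A) : Prop :=
  ∀ a b : A, b ∈ P → |a| ≤ |b| → a ∈ P

/-- The `u`-maximal ideals: the ideals that are maximal with respect to not containing the
distinguished unit. -/
structure IsUnitMaximal (A : WStar.{u}) (P : Submodule ℝ A) : Prop where
  isIdeal : A.IsIdeal P
  unit_notMem : A.unit ∉ P
  eq_of_le : ∀ Q : Submodule ℝ A, A.IsIdeal Q → A.unit ∉ Q → P ≤ Q → Q = P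

/-- The set of `u`-maximal ideals. -/
def YosidaSpace (A : WStar.{u}) : Type u := {P : Submodule ℝ A // A.IsUnitMaximal P}

/-- The hull-kernel topology, generated by the sets `{P : a ∉ P}`. -/
instance (A : WStar.{u}) : TopologicalSpace A.YosidaSpace :=
  TopologicalSpace.generateFrom (Set.range fun a : A => {P : A.YosidaSpace | a ∉ P.1})

section Yosida

variable {A : WStar.{u}}

theorem isOpen_notMem (a : A) : IsOpen {P : A.YosidaSpace | a ∉ P.1} :=
  TopologicalSpace.isOpen_generateFrom_of_mem ⟨a, rfl⟩

theorem IsIdeal.abs_mem {P : Submodule ℝ A} (hP : A.IsIdeal P) {a : A} (ha : a ∈ P) : |a| ∈ P :=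
  hP _ a ha (by rw [abs_abs])

theorem IsIdeal.mem_of_le {P : Submodule ℝ A} (hP : A.IsIdeal P) {a b : A} (hb : b ∈ P)
    (h : |a| ≤ b) : a ∈ P :=
  hP a b hb (h.trans (le_abs_self b))

theorem smul_unit_sub (r s : ℝ) : (r - s) • A.unit = r • A.unit - s • A.unit := sub_smul _ _ _

/-- The ideal generated by an ideal `P` and a set `S`. -/
def idealSup (P : Submodule ℝ A) (S : Set A) : Submodule ℝ A where
  carrier := {a | ∃ p ∈ P, ∃ t : Multiset A, (∀ x ∈ t, x ∈ S) ∧ |a| ≤ p + (t.map abs).sum}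
  zero_mem' := ⟨0, P.zero_mem, 0, by simp, by simp⟩
  add_mem' := by
    rintro a b ⟨p, hp, t, ht, ha⟩ ⟨q, hq, t', ht', hb⟩
    refine ⟨p + q, P.add_mem hp hq, t + t', ?_, ?_⟩
    · intro x hx
      rcases Multiset.mem_add.mp hx with h | h
      exacts [ht x h, ht' x h]
    · calc |a + b| ≤ |a| + |b| := abs_add_le a b
        _ ≤ (p + (t.map abs).sum) + (q + (t'.map abs).sum) := add_le_add ha hb
        _ = _ := by rw [Multiset.map_add, Multiset.sum_add]; abel
  smul_mem' := by
    rintro r a ⟨p, hp, t, ht, ha⟩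
    obtain ⟨n, hn⟩ := exists_nat_ge |r|
    have habs : |r • a| ≤ n • |a| := by
      have h0 : 0 ≤ |a| := abs_nonneg a
      have h1 : |r| • |a| ≤ (n : ℝ) • |a| := smul_le_smul_of_nonneg_right hn h0
      have h2 : |r • a| ≤ |r| • |a| := by
        refine abs_le'.mpr ⟨?_, ?_⟩
        · rcases le_total 0 r with hr | hr
          · rw [abs_of_nonneg hr]
            exact smul_le_smul_of_nonneg_left (le_abs_self a) hr
          · rw [abs_of_nonpos hr, show r • a = (-r) • (-a) by simp]
            exact smul_le_smul_of_nonneg_left (neg_le_abs a) (neg_nonneg.mpr hr)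
        · rcases le_total 0 r with hr | hr
          · rw [abs_of_nonneg hr, ← smul_neg]
            exact smul_le_smul_of_nonneg_left (neg_le_abs a) hr
          · rw [abs_of_nonpos hr, ← neg_smul]
            exact smul_le_smul_of_nonneg_left (le_abs_self a) (neg_nonneg.mpr hr)
      rw [Nat.cast_smul_eq_nsmul] at h1
      exact h2.trans h1
    refine ⟨n • p, P.nsmul_mem hp n, n • t, ?_, ?_⟩
    · intro x hx
      exact ht x (Multiset.mem_of_mem_nsmul hx)
    · calc |r • a| ≤ n • |a| := habs
        _ ≤ n • (p + (t.map abs).sum) := nsmul_le_nsmul_right ha n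
        _ = _ := by rw [Multiset.map_nsmul, Multiset.sum_nsmul, nsmul_add]

theorem isIdeal_idealSup (P : Submodule ℝ A) (S : Set A) : A.IsIdeal (idealSup P S) := by
  rintro a b ⟨p, hp, t, ht, hb⟩ hab
  exact ⟨p, hp, t, ht, hab.trans hb⟩

theorem le_idealSup {P : Submodule ℝ A} (hP : A.IsIdeal P) (S : Set A) : P ≤ idealSup P S :=
  fun a ha => ⟨|a|, hP.abs_mem ha, 0, by simp, by simp⟩

theorem subset_idealSup (P : Submodule ℝ A) (S : Set A) {x : A} (hx : x ∈ S) : x ∈ idealSup P S :=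
  ⟨0, P.zero_mem, {x}, by simpa using hx, by simp⟩

theorem isIdeal_bot : A.IsIdeal ⊥ := by
  intro a b hb hab
  have hb0 : b = 0 := by simpa using hb
  subst hb0
  rw [abs_zero] at hab
  have h1 : a ≤ 0 := (le_abs_self a).trans hab
  have h2 : -a ≤ 0 := (neg_le_abs a).trans hab
  have : a = 0 := le_antisymm h1 (by simpa using h2)
  simpa using this

theorem IsUnitMaximal.exists_le {P : Submodule ℝ A} (hP : A.IsUnitMaximal P) {x : A}
    (hx : x ∉ P) : ∃ p ∈ P, ∃ n : ℕ, A.unit ≤ p + n • |x| := by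
  by_contra hcon
  have hu : A.unit ∉ idealSup P {x} := by
    rintro ⟨p, hp, t, ht, h⟩
    refine hcon ⟨p, hp, Multiset.card t, ?_⟩
    have : t = Multiset.replicate (Multiset.card t) x :=
      Multiset.eq_replicate_card.mpr fun y hy => by simpa using ht y hy
    rw [this, Multiset.map_replicate, Multiset.sum_replicate] at h
    exact (le_abs_self _).trans h
  have := hP.eq_of_le _ (isIdeal_idealSup P {x}) hu (le_idealSup hP.isIdeal {x})
  exact hx (this ▸ subset_idealSup P {x} rfl)

theorem IsUnitMaximal.mem_or_mem {P : Submodule ℝ A} (hP : A.IsUnitMaximal P) {x y : A}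
    (hx : 0 ≤ x) (hy : 0 ≤ y) (hxy : x ⊓ y = 0) : x ∈ P ∨ y ∈ P := by
  by_contra! hcon
  obtain ⟨p, hp, n, hpn⟩ := hP.exists_le hcon.1
  obtain ⟨q, hq, m, hqm⟩ := hP.exists_le hcon.2
  rw [abs_of_nonneg hx] at hpn
  rw [abs_of_nonneg hy] at hqm
  have h1 : A.unit ≤ (|p| + |q|) + (n + m) • x := by
    calc A.unit ≤ p + n • x := hpn
      _ ≤ (|p| + |q|) + (n + m) • x := by
        refine add_le_add ((le_abs_self p).trans (le_add_of_nonneg_right (abs_nonneg q))) ?_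
        exact nsmul_le_nsmul_left hx (Nat.le_add_right n m)
  have h2 : A.unit ≤ (|p| + |q|) + (n + m) • y := by
    calc A.unit ≤ q + m • y := hqm
      _ ≤ (|p| + |q|) + (n + m) • y := by
        refine add_le_add ((le_abs_self q).trans (le_add_of_nonneg_left (abs_nonneg p))) ?_
        exact nsmul_le_nsmul_left hy (Nat.le_add_left m n)
  have h3 : ((n + m) • x) ⊓ ((n + m) • y) = 0 := by
    rcases Nat.eq_zero_or_pos (n + m) with h | h
    · simp [h]
    · have hpos : (0 : ℝ) < ((n + m : ℕ) : ℝ) := by exact_mod_cast h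
      refine le_antisymm ?_ (le_inf (nsmul_nonneg hx _) (nsmul_nonneg hy _))
      obtain ⟨z, hz⟩ : ∃ z, z = ((n + m) • x) ⊓ ((n + m) • y) := ⟨_, rfl⟩
      have hz1 : z ≤ (n + m) • x := hz ▸ inf_le_left
      have hz2 : z ≤ (n + m) • y := hz ▸ inf_le_right
      rw [← hz]
      have hzx : (((n + m : ℕ) : ℝ)⁻¹) • z ≤ x := by
        have := smul_le_smul_of_nonneg_left hz1 (inv_nonneg.mpr hpos.le)
        rwa [← Nat.cast_smul_eq_nsmul ℝ (n + m), smul_smul, inv_mul_cancel₀ hpos.ne', one_smul] at this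
      have hzy : (((n + m : ℕ) : ℝ)⁻¹) • z ≤ y := by
        have := smul_le_smul_of_nonneg_left hz2 (inv_nonneg.mpr hpos.le)
        rwa [← Nat.cast_smul_eq_nsmul ℝ (n + m), smul_smul, inv_mul_cancel₀ hpos.ne', one_smul] at this
      have h0 := le_inf hzx hzy
      rw [hxy] at h0
      have := smul_le_smul_of_nonneg_left h0 hpos.le
      rwa [smul_smul, mul_inv_cancel₀ hpos.ne', one_smul, smul_zero] at this
  have h4 : A.unit ≤ |p| + |q| := by
    have := le_inf h1 h2
    rwa [← add_inf, h3, add_zero] at this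
  refine hP.unit_notMem (hP.isIdeal.mem_of_le
    (P.add_mem (hP.isIdeal.abs_mem hp) (hP.isIdeal.abs_mem hq)) ?_)
  rwa [abs_of_nonneg A.unit_nonneg]

theorem IsUnitMaximal.smul_unit_mem {P : Submodule ℝ A} (hP : A.IsUnitMaximal P) {r : ℝ}
    (h : r • A.unit ∈ P) : r = 0 := by
  by_contra hr
  exact hP.unit_notMem ((P.smul_mem_iff hr).mp h)

theorem IsUnitMaximal.eq_of_sub_mem {P : Submodule ℝ A} (hP : A.IsUnitMaximal P) {a : A} {r s : ℝ}
    (hr : a - r • A.unit ∈ P) (hs : a - s • A.unit ∈ P) : r = s := by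
  have h : (s - r) • A.unit ∈ P := by
    have := P.sub_mem hr hs
    rwa [sub_sub_sub_cancel_left, ← sub_smul] at this
  linarith [hP.smul_unit_mem h]

theorem IsUnitMaximal.posPart_or {P : Submodule ℝ A} (hP : A.IsUnitMaximal P) (a : A) :
    a⁺ ∈ P ∨ a⁻ ∈ P :=
  hP.mem_or_mem (posPart_nonneg a) (negPart_nonneg a) (posPart_inf_negPart_eq_zero a)

theorem smul_unit_mono {r s : ℝ} (h : r ≤ s) : r • A.unit ≤ s • A.unit :=
  smul_le_smul_of_nonneg_right h A.unit_nonneg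

theorem IsUnitMaximal.exists_value {P : Submodule ℝ A} (hP : A.IsUnitMaximal P) (a : A) :
    ∃ r : ℝ, a - r • A.unit ∈ P := by
  obtain ⟨n, hn⟩ := A.exists_abs_le a
  rw [← Nat.cast_smul_eq_nsmul ℝ] at hn
  set S : Set ℝ := {s | (a - s • A.unit)⁺ ∈ P} with hS
  have hnS : (n : ℝ) ∈ S := by
    have : (a - (n : ℝ) • A.unit)⁺ = 0 :=
      posPart_eq_zero.mpr (sub_nonpos.mpr ((le_abs_self a).trans hn))
    change (a - (n : ℝ) • A.unit)⁺ ∈ P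
    rw [this]
    exact P.zero_mem
  have hbdd : BddBelow S := by
    refine ⟨-(n : ℝ), fun s hs => ?_⟩
    by_contra hlt
    have hlt : s < -(n : ℝ) := not_le.mp hlt
    have h1 : (-(n : ℝ) - s) • A.unit ≤ (a - s • A.unit)⁺ := by
      refine le_trans ?_ (le_posPart _)
      rw [sub_smul, neg_smul]
      exact sub_le_sub_right (neg_le.mp ((neg_le_abs a).trans hn)) _
    have hpos : 0 < -(n : ℝ) - s := by linarith
    have h2 : (-(n : ℝ) - s) • A.unit ∈ P := by
      refine hP.isIdeal.mem_of_le hs ?_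
      rwa [abs_of_nonneg (smul_nonneg hpos.le A.unit_nonneg)]
    exact hpos.ne' (hP.smul_unit_mem h2)
  refine ⟨sInf S, ?_⟩
  by_contra hnot
  obtain ⟨p, hp, m, hpm⟩ := hP.exists_le hnot
  set r := sInf S with hr
  set ε : ℝ := 1 / (2 * ((m : ℝ) + 1)) with hε
  have hm : (0 : ℝ) < (m : ℝ) + 1 := by positivity
  have hεpos : 0 < ε := by positivity
  obtain ⟨s, hsS, hs⟩ := exists_lt_of_csInf_lt ⟨_, hnS⟩ (show sInf S < r + ε by linarith)
  have hneg : (a - (r - ε) • A.unit)⁻ ∈ P := by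
    refine (hP.posPart_or _).resolve_left fun h => ?_
    have : sInf S ≤ r - ε := csInf_le hbdd h
    linarith
  have hbound : |a - r • A.unit| ≤ (a - s • A.unit)⁺ + (a - (r - ε) • A.unit)⁻ + ε • A.unit := by
    refine abs_le'.mpr ⟨?_, ?_⟩
    · have h1 : a - r • A.unit ≤ (a - s • A.unit) + ε • A.unit := by
        have := smul_unit_mono (A := A) (show s ≤ r + ε from hs.le)
        rw [add_smul] at this
        calc a - r • A.unit = a - (r • A.unit + ε • A.unit) + ε • A.unit := by abel
          _ ≤ _ := add_le_add_left (sub_le_sub_left this a) _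
      refine h1.trans (add_le_add_left ((le_posPart _).trans ?_) _)
      exact le_add_of_nonneg_right (negPart_nonneg _)
    · have h1 : -(a - r • A.unit) = -(a - (r - ε) • A.unit) + ε • A.unit := by
        rw [sub_smul]; abel
      rw [h1]
      refine add_le_add_left ((neg_le_negPart _).trans ?_) _
      exact le_add_of_nonneg_left (posPart_nonneg _)
  have hq : p + m • ((a - s • A.unit)⁺ + (a - (r - ε) • A.unit)⁻) ∈ P :=
    P.add_mem hp (P.nsmul_mem (P.add_mem hsS hneg) m)
  have hmε : (m : ℝ) * ε ≤ 1 / 2 := by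
    rw [hε, mul_one_div, div_le_div_iff₀ (by positivity) (by norm_num)]
    linarith
  have hle : A.unit ≤ p + m • ((a - s • A.unit)⁺ + (a - (r - ε) • A.unit)⁻) +
      (1 / 2 : ℝ) • A.unit := by
    calc A.unit ≤ p + m • |a - r • A.unit| := hpm
      _ ≤ p + m • ((a - s • A.unit)⁺ + (a - (r - ε) • A.unit)⁻ + ε • A.unit) :=
        add_le_add_right (nsmul_le_nsmul_right hbound m) p
      _ = p + m • ((a - s • A.unit)⁺ + (a - (r - ε) • A.unit)⁻) + ((m : ℝ) * ε) • A.unit := by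
        rw [nsmul_add, ← Nat.cast_smul_eq_nsmul ℝ m (ε • A.unit), smul_smul]; abel
      _ ≤ _ := add_le_add_right (smul_unit_mono hmε) _
  have hhalf : (1 / 2 : ℝ) • A.unit ≤ p + m • ((a - s • A.unit)⁺ + (a - (r - ε) • A.unit)⁻) := by
    have h := sub_le_iff_le_add.mpr hle
    have h2 : A.unit - (1 / 2 : ℝ) • A.unit = (1 / 2 : ℝ) • A.unit := by
      rw [show A.unit - (1 / 2 : ℝ) • A.unit = (1 : ℝ) • A.unit - (1 / 2 : ℝ) • A.unit by
        rw [one_smul], ← sub_smul]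
      norm_num
    rwa [h2] at h
  have hmem : (1 / 2 : ℝ) • A.unit ∈ P := by
    refine hP.isIdeal.mem_of_le hq ?_
    rwa [abs_of_nonneg (smul_nonneg (by norm_num) A.unit_nonneg)]
  exact absurd (hP.smul_unit_mem hmem) (by norm_num)

/-- The value of `a` at a `u`-maximal ideal `P`: the unique real `r` with `a - r u ∈ P`. -/
noncomputable def value (a : A) (P : A.YosidaSpace) : ℝ := (P.2.exists_value a).choose

theorem sub_value_mem (a : A) (P : A.YosidaSpace) : a - value a P • A.unit ∈ P.1 :=
  (P.2.exists_value a).choose_spec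

theorem value_eq {a : A} {P : A.YosidaSpace} {r : ℝ} (h : a - r • A.unit ∈ P.1) :
    value a P = r :=
  P.2.eq_of_sub_mem (sub_value_mem a P) h

theorem value_eq_zero {a : A} {P : A.YosidaSpace} : value a P = 0 ↔ a ∈ P.1 := by
  constructor
  · intro h
    simpa [h] using sub_value_mem a P
  · intro h
    exact value_eq (by simpa using h)

theorem value_add (a b : A) (P : A.YosidaSpace) : value (a + b) P = value a P + value b P := by
  refine value_eq ?_
  have := P.1.add_mem (sub_value_mem a P) (sub_value_mem b P)
  rwa [← add_sub_add_comm, ← add_smul] at this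

theorem value_smul (r : ℝ) (a : A) (P : A.YosidaSpace) : value (r • a) P = r * value a P := by
  refine value_eq ?_
  have := P.1.smul_mem r (sub_value_mem a P)
  rwa [smul_sub, smul_smul] at this

theorem value_unit (P : A.YosidaSpace) : value A.unit P = 1 :=
  value_eq (by simp)

theorem value_nonneg {a : A} (ha : 0 ≤ a) (P : A.YosidaSpace) : 0 ≤ value a P := by
  by_contra! h
  have hpos : 0 < -value a P := by linarith
  have : (-value a P) • A.unit ∈ P.1 := by
    refine P.2.isIdeal.mem_of_le (sub_value_mem a P) ?_
    rw [abs_of_nonneg (smul_nonneg hpos.le A.unit_nonneg), neg_smul, sub_eq_add_neg]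
    exact le_add_of_nonneg_left ha
  exact hpos.ne' (P.2.smul_unit_mem this)

theorem value_neg (a : A) (P : A.YosidaSpace) : value (-a) P = -value a P := by
  rw [← neg_one_smul ℝ a, value_smul]; ring

theorem value_sub (a b : A) (P : A.YosidaSpace) : value (a - b) P = value a P - value b P := by
  rw [sub_eq_add_neg, value_add, value_neg]; ring

theorem value_posPart (a : A) (P : A.YosidaSpace) : value a⁺ P = max (value a P) 0 := by
  have h := value_sub a⁺ a⁻ P
  rw [posPart_sub_negPart] at h
  have h1 := value_nonneg (posPart_nonneg a) P
  have h2 := value_nonneg (negPart_nonneg a) P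
  rcases P.2.posPart_or a with hp | hp
  · have h0 := value_eq_zero.mpr hp
    rw [h0, max_eq_right (by linarith)]
  · have h0 := value_eq_zero.mpr hp
    rw [max_eq_left (by linarith)]
    linarith

theorem value_sup (a b : A) (P : A.YosidaSpace) : value (a ⊔ b) P = value a P ⊔ value b P := by
  have h : a ⊔ b = (a - b)⁺ + b := by
    rw [posPart_def, sup_add, sub_add_cancel, zero_add]
  rw [h, value_add, value_posPart, value_sub, max_add]
  simp

theorem value_inf (a b : A) (P : A.YosidaSpace) : value (a ⊓ b) P = value a P ⊓ value b P := by
  have h : a ⊓ b = -(-a ⊔ -b) := by rw [neg_sup, neg_neg, neg_neg]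
  rw [h, value_neg, value_sup, value_neg, value_neg, neg_sup, neg_neg, neg_neg]

theorem isOpen_lt_value (a : A) (r : ℝ) : IsOpen {P : A.YosidaSpace | r < value a P} := by
  convert isOpen_notMem ((a - r • A.unit)⁺) using 1
  ext P
  simp only [Set.mem_ofPred_eq]
  rw [← value_eq_zero, value_posPart, value_sub, value_smul, value_unit, mul_one, max_eq_right_iff,
    sub_nonpos, not_le]

theorem continuous_value (a : A) : Continuous (value a : A.YosidaSpace → ℝ) := by
  rw [continuous_iff_lower_upperSemicontinuous]
  refine ⟨lowerSemicontinuous_iff_isOpen_preimage.mpr fun r => isOpen_lt_value a r,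
    upperSemicontinuous_iff_isOpen_preimage.mpr fun r => ?_⟩
  convert isOpen_lt_value (-a) (-r) using 1
  ext P
  simp [value_neg]

instance : T2Space A.YosidaSpace := by
  refine ⟨fun P Q hPQ => ?_⟩
  have hne : ¬ P.1 ≤ Q.1 := fun h =>
    hPQ (Subtype.ext (P.2.eq_of_le Q.1 Q.2.isIdeal Q.2.unit_notMem h).symm)
  obtain ⟨a, haP, haQ⟩ := Set.not_subset.mp hne
  have h : value a P ≠ value a Q := by
    rw [value_eq_zero.mpr haP]
    exact fun h => haQ (value_eq_zero.mp h.symm)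
  exact separated_by_continuous (continuous_value a) h

theorem exists_isUnitMaximal_ge {I : Submodule ℝ A} (hI : A.IsIdeal I) (hu : A.unit ∉ I) :
    ∃ P : A.YosidaSpace, I ≤ P.1 := by
  obtain ⟨P, hIP, hP⟩ := zorn_le_nonempty₀ {Q : Submodule ℝ A | A.IsIdeal Q ∧ A.unit ∉ Q}
    (fun c hc hchain Q hQ => by
      have hdir : DirectedOn (· ≤ ·) c := hchain.directedOn
      refine ⟨sSup c, ⟨?_, ?_⟩, fun R hR => le_sSup hR⟩
      · intro a b hb hab
        obtain ⟨R, hR, hbR⟩ := (Submodule.mem_sSup_of_directed ⟨Q, hQ⟩ hdir).mp hb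
        exact (Submodule.mem_sSup_of_directed ⟨Q, hQ⟩ hdir).mpr ⟨R, hR, (hc hR).1 a b hbR hab⟩
      · intro hmem
        obtain ⟨R, hR, huR⟩ := (Submodule.mem_sSup_of_directed ⟨Q, hQ⟩ hdir).mp hmem
        exact (hc hR).2 huR) I ⟨hI, hu⟩
  exact ⟨⟨P, hP.prop.1, hP.prop.2, fun Q hQ hQu hPQ =>
    le_antisymm (hP.le_of_ge ⟨hQ, hQu⟩ hPQ) hPQ⟩, hIP⟩

instance : CompactSpace A.YosidaSpace := by
  refine ⟨isCompact_generateFrom rfl fun 𝒰 h𝒰 hcov => ?_⟩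
  set S : Set A := {a | {P : A.YosidaSpace | a ∉ P.1} ∈ 𝒰} with hS
  have hu : A.unit ∈ idealSup (⊥ : Submodule ℝ A) S := by
    by_contra hu
    obtain ⟨P, hP⟩ := exists_isUnitMaximal_ge (isIdeal_idealSup _ S) hu
    obtain ⟨U, hU, hPU⟩ := hcov (Set.mem_univ P)
    obtain ⟨a, rfl⟩ := h𝒰 hU
    exact hPU (hP (subset_idealSup _ S hU))
  obtain ⟨p, hp, t, ht, hle⟩ := hu
  have hp0 : p = 0 := by simpa using hp
  rw [hp0, zero_add] at hle
  refine ⟨(fun a : A => {P : A.YosidaSpace | a ∉ P.1}) '' {a | a ∈ t}, ?_, ?_, ?_⟩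
  · rintro _ ⟨a, ha, rfl⟩
    exact ht a ha
  · exact (Multiset.finite_toSet t).image _
  · intro P _
    by_contra hcon
    have hall : ∀ a ∈ t, a ∈ P.1 := by
      intro a ha
      by_contra haP
      exact hcon ⟨_, ⟨a, ha, rfl⟩, haP⟩
    refine P.2.unit_notMem (P.2.isIdeal.mem_of_le (P.1.multiset_sum_mem _ ?_) hle)
    intro x hx
    obtain ⟨a, ha, rfl⟩ := Multiset.mem_map.mp hx
    exact P.2.isIdeal.abs_mem (hall a ha)

end Yosida

/-- The Yosida space `YA` as a compact Hausdorff space. -/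
def Y (A : WStar.{u}) : CompHaus.{u} := CompHaus.of A.YosidaSpace

/-- The Yosida embedding `ν_A : A → C(YA)`: `ν_A(a)(P)` is the real `r` with `a - r u ∈ P`. -/
noncomputable def nu (A : WStar.{u}) : Hom A (ofCompHaus A.Y) where
  toLin :=
    { toFun := fun a => (⟨value a, continuous_value a⟩ : C(A.YosidaSpace, ℝ))
      map_add' := fun a b => ContinuousMap.ext fun P => value_add a b P
      map_smul' := fun r a => ContinuousMap.ext fun P => value_smul r a P }
  map_sup' a b := ContinuousMap.ext fun P => value_sup a b P
  map_inf' a b := ContinuousMap.ext fun P => value_inf a b P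
  map_unit' := ContinuousMap.ext fun P => value_unit P

theorem Hom.map_abs {A B : WStar.{u}} (φ : Hom A B) (a : A) : φ |a| = |φ a| := by
  simp only [abs, φ.map_sup', map_neg]

theorem Hom.isUnitMaximal_comap {A B : WStar.{u}} (φ : Hom A B) (Q : B.YosidaSpace) :
    A.IsUnitMaximal (Q.1.comap φ.toLin) where
  isIdeal a b hb hab := by
    refine Q.2.isIdeal (φ a) (φ b) hb ?_
    rw [← φ.map_abs, ← φ.map_abs, ← sup_eq_right, ← φ.map_sup', sup_eq_right.mpr hab]
  unit_notMem h := by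
    rw [Submodule.mem_comap, φ.map_unit'] at h
    exact Q.2.unit_notMem h
  eq_of_le I _ hIu hle := by
    refine le_antisymm (fun x hx => ?_) hle
    have h1 : x - value (φ x) Q • A.unit ∈ Q.1.comap φ.toLin := by
      rw [Submodule.mem_comap, map_sub, map_smul, φ.map_unit']
      exact sub_value_mem (φ x) Q
    have h2 : value (φ x) Q • A.unit ∈ I := by
      have := I.sub_mem hx (hle h1)
      rwa [sub_sub_cancel] at this
    have h3 : value (φ x) Q = 0 := by
      by_contra h
      exact hIu ((I.smul_mem_iff h).mp h2)
    exact value_eq_zero.mp h3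

/-- The continuous map `Yφ : YB → YA`, `Q ↦ φ⁻¹(Q)`, induced by a morphism `φ : A → B`. -/
def Hom.Y {A B : WStar.{u}} (φ : Hom A B) : C(B.Y, A.Y) where
  toFun := fun Q : B.YosidaSpace => (⟨Q.1.comap φ.toLin, φ.isUnitMaximal_comap Q⟩ : A.YosidaSpace)
  continuous_toFun := by
    refine continuous_generateFrom_iff.mpr ?_
    rintro _ ⟨a, rfl⟩
    exact isOpen_notMem (φ a)

/-- `F(X)`: the continuous real functions on `X` with finite range. -/
def finiteRange (X : CompHaus.{u}) : Set (ofCompHaus X) :=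
  {f : C(X, ℝ) | (Set.range f).Finite}

/-! ## Hulls and the operator `μ` -/

/-- A function assigning to each `A` an object `hA` and a morphism `h_A : A → hA`. -/
structure HullAssignment where
  obj : WStar.{u} → WStar.{u}
  map : ∀ A : WStar.{u}, Hom A (obj A)

/-- The class of objects `A` for which `h_A` is an isomorphism (that is, `A = hA`). -/
def HullAssignment.fix (h : HullAssignment.{u}) : Set WStar.{u} := {A | (h.map A).IsIso}

/-- The pair `(A, φ)`, `φ : A → H`, belongs to `{A : hA = H}`: the pairs `(H, φ)` and `(hA, h_A)`
are equivalent extensions of `A`. -/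
def HullAssignment.MemV (h : HullAssignment.{u}) (H A : WStar.{u}) (φ : Hom A H) : Prop :=
  ∃ e : Hom H (h.obj A), e.IsIso ∧ e.comp φ = h.map A

/-- The pair `(M, φ)` is the minimum of `{A : hA = H}`, where `(A₁, φ₁) ≤ (A₂, φ₂)` means that
`φ₁ = φ₂ ∘ f` for an essential embedding `f : A₁ → A₂`. -/
def HullAssignment.IsMinimumV (h : HullAssignment.{u}) (H M : WStar.{u}) (φ : Hom M H) : Prop :=
  h.MemV H M φ ∧ ∀ (A : WStar.{u}) (ψ : Hom A H), h.MemV H A ψ →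
    ∃ f : Hom M A, f.IsEssentialEmbedding ∧ φ = ψ.comp f

/-- `μ(c)A = C(cYA)`, with `μ(c)_A : A → C(YA) → C(cYA)`, `a ↦ ν_A(a) ∘ c_{YA}`. -/
noncomputable def mu (c : CoveringOperator.{u}) : HullAssignment.{u} where
  obj A := ofCompHaus (c.obj A.Y)
  map A := (pullback (c.map A.Y)).comp A.nu

end WStar

/-! ## Irreducible maps and transport of covers -/

/-! The functor `A ↦ YA` turns one minimum problem into the other. Since `μ(c)H = H`, the embedding
`ν_H` is onto, so `H` is a copy of `C(YH)`, and `(A, φ)` lies in V(H, μ(c)) exactly when `(YA, Yφ)`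
lies in S(YH, c) (`memV_iff`). Conversely, any object that embeds in `C(X)` and separates points has
Yosida space `X`, so over each member `X` of S there are many members of V (`exists_memV`).

A minimum `M` of V is below all of them. Comparison with `C(X)` gives, by duality, a map `X → YM`,
so `YM` is the minimum of S. Comparison with the functions on `YM` that are constant near `p`, for
each point `p`, makes every element of `M` locally constant on `YM`; by compactness it has finite
range, and `YM` is zero-dimensional.

For the converse, `ν_A(A)` always contains `F(YA)` (`finiteRange_subset_range_nu`). If `M = F(YM)`
and `g : YA → YM` comes from minimality in S, composition with `g` therefore sends `M` into `A`. Its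
dual is `g`, which is irreducible, so the embedding is essential. -/

theorem IsCover.eq_id_of_comp_eq {X Y : Type u} [TopologicalSpace X] [TopologicalSpace Y]
    [T2Space Y] {f : C(Y, X)} (hf : IsCover f) {s : C(Y, Y)} (hs : ∀ y, f (s y) = f y) (y : Y) :
    s y = y := by
  by_contra hne
  obtain ⟨V, U, hV, hU, hyV, hyU, hVU⟩ := t2_separation hne
  -- The open set `U ∩ s⁻¹(V)` contains `y`, and `s` maps it off itself within the fibres of `f`.
  -- Its complement is thus a proper closed set that still meets every fibre.
  refine hf.irreducible (U ∩ s ⁻¹' V)ᶜ (hU.inter (hV.preimage s.continuous)).isClosed_compl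
    (fun h => ?_) (Set.eq_univ_of_forall fun x => ?_)
  · have : y ∈ (U ∩ s ⁻¹' V)ᶜ := h ▸ Set.mem_univ y
    exact this ⟨hyU, hyV⟩
  · obtain ⟨z, rfl⟩ := hf.surjective x
    by_cases hz : z ∈ U ∩ s ⁻¹' V
    · exact ⟨s z, fun h => Set.disjoint_left.mp hVU hz.2 h.1, hs z⟩
    · exact ⟨z, hz, rfl⟩

theorem IsCover.homeomorph_comp {X X' Y : Type u} [TopologicalSpace X] [TopologicalSpace X']
    [TopologicalSpace Y] {f : C(Y, X)} (hf : IsCover f) (η : X ≃ₜ X') :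
    IsCover ((η : C(X, X')).comp f) where
  surjective := η.surjective.comp hf.surjective
  isClosedMap := η.isClosedMap.comp hf.isClosedMap
  isCompact_fiber x := by
    convert hf.isCompact_fiber (η.symm x) using 1
    ext y
    exact (η.toEquiv.eq_symm_apply).symm
  irreducible F hF hne h := by
    refine hf.irreducible F hF hne (Set.eq_univ_of_forall fun x => ?_)
    obtain ⟨y, hy, hyx⟩ := h.symm ▸ Set.mem_univ (η x)
    exact ⟨y, hy, η.injective hyx⟩

/-- A proper closed set with full image under `g` would pull back along `k` to one with full image
under `g ∘ k`. This is applied to the comparison map from a member of S(K, c) to the minimum. -/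
theorem IsCover.of_comp {X Y Z : Type u} [TopologicalSpace X] [TopologicalSpace Y]
    [TopologicalSpace Z] [CompactSpace Y] [T2Space X] {g : C(Y, X)} {k : C(Z, Y)}
    (h : IsCover (g.comp k)) (hk : Function.Surjective k) : IsCover g where
  surjective := Function.Surjective.of_comp h.surjective
  isClosedMap := g.continuous.isClosedMap
  isCompact_fiber _ := (isClosed_singleton.preimage g.continuous).isCompact
  irreducible F hF hne hFu := by
    refine h.irreducible (k ⁻¹' F) (hF.preimage k.continuous) (fun h' => hne ?_) ?_
    · rw [← Set.image_preimage_eq F hk, h', Set.image_univ, hk.range_eq]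
    · rw [ContinuousMap.coe_comp, Set.image_comp, Set.image_preimage_eq F hk, hFu]

/-! ### Homeomorphism invariance of S(K, c) -/

namespace CoveringOperator

variable (c : CoveringOperator.{u}) {K X X' : CompHaus.{u}}

/-- Homeomorphic spaces have equivalent minimal covers in `fix c`. -/
theorem exists_homeomorph_obj (η : X ≃ₜ X') :
    ∃ h : c.obj X ≃ₜ c.obj X', ∀ y, c.map X' (h y) = η (c.map X y) := by
  obtain ⟨g, hg⟩ := c.obj_le X' (c.obj X) _ ((c.isCover X).homeomorph_comp η) (c.obj_mem_fix X)
  obtain ⟨g', hg'⟩ :=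
    c.obj_le X (c.obj X') _ ((c.isCover X').homeomorph_comp η.symm) (c.obj_mem_fix X')
  have h1 (y : c.obj X) : η (c.map X y) = c.map X' (g y) := DFunLike.congr_fun hg y
  have h2 (y : c.obj X') : η.symm (c.map X' y) = c.map X (g' y) := DFunLike.congr_fun hg' y
  -- Both composites commute with the covering maps, so rigidity of irreducible covers makes them
  -- identities.
  refine ⟨⟨⟨g, g', fun y => ?_, fun y => ?_⟩, g.continuous, g'.continuous⟩, fun y => (h1 y).symm⟩
  · exact (c.isCover X).eq_id_of_comp_eq (s := g'.comp g)
      (fun y => by simp [← h2, ← h1]) y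
  · exact (c.isCover X').eq_id_of_comp_eq (s := g.comp g')
      (fun y => by simp [← h2, ← h1]) y

variable {c}

theorem MemS.homeomorph_comp {f : C(K, X)} (hf : c.MemS K X f) (η : X ≃ₜ X') :
    c.MemS K X' ((η : C(X, X')).comp f) := by
  obtain ⟨h, hh⟩ := hf
  obtain ⟨e, he⟩ := c.exists_homeomorph_obj η
  exact ⟨h.trans e, fun k => by simp [he, hh]⟩

theorem MemS.isCover {f : C(K, X)} (hf : c.MemS K X f) : IsCover f := by
  obtain ⟨h, hh⟩ := hf
  have hc := c.isCover X
  have hfh : (f : K → X) = c.map X ∘ h := funext fun k => (hh k).symm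
  refine ⟨hfh ▸ hc.surjective.comp h.surjective, hfh ▸ hc.isClosedMap.comp h.isClosedMap,
    fun x => ?_, fun F hF hne hFu => ?_⟩
  · rw [hfh, Set.preimage_comp]
    exact h.isCompact_preimage.mpr (hc.isCompact_fiber x)
  · refine hc.irreducible (h '' F) (h.isClosedMap F hF) (fun h' => hne ?_) ?_
    · rwa [← h.surjective.range_eq, ← Set.image_univ, h.injective.image_injective.eq_iff] at h'
    · rw [← hFu, hfh, Set.image_comp]

end CoveringOperator

/-- Functions that are constant near a given point separate points. -/
theorem exists_continuous_eventually_const_ne {X : Type u} [TopologicalSpace X] [CompactSpace X]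
    [T2Space X] (p : X) {x y : X} (hxy : x ≠ y) :
    ∃ f : C(X, ℝ), (∀ᶠ z in nhds p, f z = f p) ∧ f x ≠ f y := by
  -- At most one of `x`, `y` equals `p`; name the other one `x`. A function that is 1 at `x` and 0
  -- at `y` and on a closed neighbourhood of `p` then works, even when `y = p`.
  wlog hxp : x ≠ p generalizing x y
  · obtain ⟨f, hf, hne⟩ := this hxy.symm fun h => hxy (by rw [h, not_not.mp hxp])
    exact ⟨f, hf, hne.symm⟩
  obtain ⟨V, hV, hVcl, hVx⟩ := exists_mem_nhds_isClosed_subset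
    (isOpen_compl_singleton.mem_nhds (Set.mem_compl_singleton_iff.mpr hxp.symm))
  obtain ⟨f, hf0, hf1, -⟩ := exists_continuous_zero_one_of_isClosed
    (hVcl.union (isClosed_singleton (x := y))) (isClosed_singleton (x := x))
    (Set.disjoint_singleton_right.mpr fun h => h.elim (fun h => hVx h rfl) hxy)
  refine ⟨f, ?_, ?_⟩
  · filter_upwards [hV] with z hz
    rw [hf0 (Or.inl hz), hf0 (Or.inl (mem_of_mem_nhds hV))]
    rfl
  · rw [hf0 (Or.inr rfl), hf1 rfl]
    exact one_ne_zero

namespace WStar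

/-! ## The Yosida representation -/

section Yosida

variable {A : WStar.{u}}

theorem value_ext {P Q : A.YosidaSpace} (h : ∀ a : A, value a P = value a Q) : P = Q :=
  Subtype.ext (Submodule.ext fun a => by rw [← value_eq_zero, ← value_eq_zero, h])

theorem exists_le_nsmul_unit (a : A) : ∃ n : ℕ, a ≤ n • A.unit :=
  (A.exists_abs_le a).imp fun _ h => (le_abs_self a).trans h

/-- An element all of whose values are negative is nonpositive. -/
theorem le_zero_of_value_neg {a : A} (h : ∀ P : A.YosidaSpace, value a P < 0) : a ≤ 0 := by
  -- Otherwise some `P` contains `a⁻`, and there `a` has the same value as `a⁺`, which is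
  -- nonnegative.
  have hu : A.unit ∈ idealSup (⊥ : Submodule ℝ A) {a⁻} := by
    by_contra hu
    obtain ⟨P, hP⟩ := exists_isUnitMaximal_ge (isIdeal_idealSup _ _) hu
    have h0 := value_eq_zero.mpr (hP (subset_idealSup _ _ rfl))
    have h1 := value_nonneg (posPart_nonneg a) P
    have h2 := value_sub a⁺ a⁻ P
    rw [posPart_sub_negPart] at h2
    linarith [h P]
  obtain ⟨p, hp, t, ht, hle⟩ := hu
  have hp0 : p = 0 := by simpa using hp
  have ht' : t = Multiset.replicate (Multiset.card t) a⁻ :=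
    Multiset.eq_replicate_card.mpr fun y hy => by simpa using ht y hy
  rw [ht', hp0, zero_add, Multiset.map_replicate, Multiset.sum_replicate,
    abs_of_nonneg (negPart_nonneg a)] at hle
  obtain ⟨k, hk⟩ := exists_le_nsmul_unit a⁺
  -- The `+ 1` ensures `N ≥ 1`, so that `N⁻¹ • a⁺` lies below both `a⁺` and `a⁻`, whose infimum is
  -- 0.
  have hN : a⁺ ≤ (k * Multiset.card t + 1 : ℕ) • a⁻ := by
    refine (hk.trans (nsmul_le_nsmul_right ((le_abs_self _).trans hle) k)).trans ?_
    rw [← mul_nsmul']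
    exact nsmul_le_nsmul_left (negPart_nonneg a) (Nat.le_succ _)
  obtain ⟨N, hNdef⟩ : ∃ N, N = k * Multiset.card t + 1 := ⟨_, rfl⟩
  rw [← hNdef, ← Nat.cast_smul_eq_nsmul ℝ] at hN
  have hN1 : (1 : ℝ) ≤ N := by
    rw [hNdef]
    exact_mod_cast Nat.le_add_left 1 _
  have hNpos : (0 : ℝ) < N := by linarith
  have h1 : (N : ℝ)⁻¹ • a⁺ ≤ a⁻ := by
    have := smul_le_smul_of_nonneg_left hN (inv_nonneg.mpr hNpos.le)
    rwa [smul_smul, inv_mul_cancel₀ hNpos.ne', one_smul] at this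
  have h2 : (N : ℝ)⁻¹ • a⁺ ≤ a⁺ := by
    have := smul_le_smul_of_nonneg_right (inv_le_one_of_one_le₀ hN1) (posPart_nonneg a)
    rwa [one_smul] at this
  have h3 := le_inf h2 h1
  rw [posPart_inf_negPart_eq_zero] at h3
  have h4 := smul_le_smul_of_nonneg_left h3 hNpos.le
  rw [smul_smul, mul_inv_cancel₀ hNpos.ne', one_smul, smul_zero] at h4
  exact (le_posPart a).trans h4

/-- Subtracting the unit makes the values of `n • a - u` strictly negative, so `n • a ≤ u` for all
`n`; the Archimedean axiom then removes `u`. -/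
theorem nonpos_of_value_nonpos {a : A} (h : ∀ P : A.YosidaSpace, value a P ≤ 0) : a ≤ 0 := by
  refine A.archimedean a A.unit fun n => sub_nonpos.mp ?_
  refine le_zero_of_value_neg fun P => ?_
  rw [value_sub, value_unit, ← Nat.cast_smul_eq_nsmul ℝ, value_smul]
  nlinarith [h P, Nat.cast_nonneg (α := ℝ) n]

/-- The evaluation of continuous functions at `x`, as a linear form. -/
def ev {X : CompHaus.{u}} (x : X) : ofCompHaus X →ₗ[ℝ] ℝ where
  toFun := fun f : C(X, ℝ) => f x
  map_add' _ _ := rfl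
  map_smul' _ _ := rfl

theorem ofCompHaus_ext {X : CompHaus.{u}} {f g : ofCompHaus X} (h : ∀ x : X, ev x f = ev x g) :
    f = g :=
  ContinuousMap.ext h

theorem nu_injective (A : WStar.{u}) : Function.Injective A.nu := by
  intro a b hab
  have h (P : A.YosidaSpace) : value a P = value b P := congrArg (ev (X := A.Y) P) hab
  refine le_antisymm (sub_nonpos.mp ?_) (sub_nonpos.mp ?_) <;>
    exact nonpos_of_value_nonpos fun P => by simp [value_sub, h]

/-- The image of the Yosida embedding is uniformly dense. -/
theorem exists_value_approx (f : C(A.YosidaSpace, ℝ)) {ε : ℝ} (hε : 0 < ε) :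
    ∃ a : A, ∀ P, |value a P - f P| < ε := by
  let L : Set C(A.YosidaSpace, ℝ) := Set.range fun a : A => ⟨value a, continuous_value a⟩
  have hL : closure L = ⊤ := by
    -- The lattice form of Stone–Weierstrass asks for interpolation at any two points; a combination
    -- of the unit and an element separating them provides it.
    refine ContinuousMap.sublattice_closure_eq_top L ⟨_, 0, rfl⟩ ?_ ?_ ?_
    · rintro _ ⟨a, rfl⟩ _ ⟨b, rfl⟩
      exact ⟨a ⊓ b, ContinuousMap.ext fun P => value_inf a b P⟩
    · rintro _ ⟨a, rfl⟩ _ ⟨b, rfl⟩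
      exact ⟨a ⊔ b, ContinuousMap.ext fun P => value_sup a b P⟩
    · intro v P Q
      suffices ∃ a : A, value a P = v P ∧ value a Q = v Q by
        obtain ⟨a, ha⟩ := this
        exact ⟨_, ⟨a, rfl⟩, ha⟩
      by_cases hPQ : P = Q
      · subst hPQ
        exact ⟨v P • A.unit, by simp [value_smul, value_unit]⟩
      · obtain ⟨b, hb⟩ : ∃ b : A, value b P ≠ value b Q := by
          by_contra! h
          exact hPQ (value_ext h)
        have hb' : value b P - value b Q ≠ 0 := sub_ne_zero.mpr hb
        refine ⟨((v P - v Q) / (value b P - value b Q)) • (b - value b Q • A.unit) +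
          v Q • A.unit, ?_, ?_⟩
        · rw [value_add, value_smul, value_sub, value_smul, value_smul, value_unit]
          field_simp
          ring
        · rw [value_add, value_smul, value_sub, value_smul, value_smul, value_unit]
          ring
  have hf : f ∈ closure L := hL ▸ Set.mem_univ f
  obtain ⟨_, ⟨a, rfl⟩, ha⟩ := Metric.mem_closure_iff.mp hf ε hε
  refine ⟨a, fun P => ?_⟩
  rw [← Real.dist_eq, dist_comm]
  exact (ContinuousMap.dist_apply_le_dist P).trans_lt ha

/-- Density only approximates a Urysohn function. Within an error 1/3, the truncation `(3a - u)⁺ ⊓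
u` makes the values on `F` and `G` exact. -/
theorem exists_value_zero_one {F G : Set A.YosidaSpace} (hF : IsClosed F) (hG : IsClosed G)
    (hFG : Disjoint F G) : ∃ a : A, (∀ P ∈ F, value a P = 0) ∧ ∀ P ∈ G, value a P = 1 := by
  obtain ⟨f, hf0, hf1, -⟩ := exists_continuous_zero_one_of_isClosed hF hG hFG
  obtain ⟨a, ha⟩ := exists_value_approx f (ε := 1 / 3) (by norm_num)
  have hval (P : A.YosidaSpace) :
      value (((3 : ℝ) • a - A.unit)⁺ ⊓ A.unit) P = min (max (3 * value a P - 1) 0) 1 := by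
    rw [value_inf, value_posPart, value_sub, value_smul, value_unit]
  refine ⟨((3 : ℝ) • a - A.unit)⁺ ⊓ A.unit, fun P hP => ?_, fun P hP => ?_⟩
  · have h := abs_lt.mp (ha P)
    have h0 : f P = 0 := hf0 hP
    rw [hval, max_eq_right (by linarith), min_eq_left zero_le_one]
  · have h := abs_lt.mp (ha P)
    have h1 : f P = 1 := hf1 hP
    rw [hval, max_eq_left (by linarith), min_eq_right (by linarith)]

/-- Every continuous function with finite range on `YA` comes from `A`. -/
theorem finiteRange_subset_range_nu (A : WStar.{u}) : finiteRange A.Y ⊆ Set.range A.nu := by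
  intro f hf
  change C(A.YosidaSpace, ℝ) at f
  have hfin : (Set.range f).Finite := hf
  -- Finite range makes each level set clopen, so its indicator function comes from `A`; `f` is a
  -- linear combination of these indicators.
  have key (r : ℝ) : ∃ a : A, (∀ P ∈ {P | f P ≠ r}, value a P = 0) ∧
      ∀ P ∈ {P | f P = r}, value a P = 1 := by
    refine exists_value_zero_one ?_ (isClosed_eq f.continuous continuous_const)
      (Set.disjoint_left.mpr fun P h h' => h h')
    convert ((hfin.subset (Set.sdiff_subset (t := {r}))).isClosed).preimage f.continuous using 1
    ext P
    simp
  choose a ha0 ha1 using key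
  refine ⟨∑ r ∈ hfin.toFinset, r • a r, ?_⟩
  refine ofCompHaus_ext fun P => ?_
  change A.YosidaSpace at P
  let v : A →ₗ[ℝ] ℝ :=
    { toFun := fun a => value a P
      map_add' := fun a b => value_add a b P
      map_smul' := fun r a => value_smul r a P }
  change v (∑ r ∈ hfin.toFinset, r • a r) = f P
  rw [map_sum, Finset.sum_eq_single (f P)]
  · change value (f P • a (f P)) P = f P
    rw [value_smul, ha1 _ P rfl, mul_one]
  · intro r _ hr
    change value (r • a r) P = 0
    rw [value_smul, ha0 _ P (Ne.symm hr), mul_zero]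
  · intro h
    exact absurd (hfin.mem_toFinset.mpr ⟨P, rfl⟩) h

end Yosida

/-! ## Morphisms into `C(X)` and maps into Yosida spaces -/

section Dual

variable {A B : WStar.{u}} {X : CompHaus.{u}}

theorem value_Y (φ : Hom A B) (a : A) (Q : B.YosidaSpace) :
    value (A := A) a (φ.Y Q) = value (φ a) Q := by
  refine value_eq ?_
  change φ.toLin (a - value (φ a) Q • A.unit) ∈ Q.1
  rw [map_sub, map_smul, φ.map_unit']
  exact sub_value_mem (φ a) Q

theorem ev_abs (x : X) (f : ofCompHaus X) : ev x |f| = |ev x f| :=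
  rfl

theorem ev_unit (x : X) : ev x (ofCompHaus X).unit = 1 := rfl

theorem ev_mono (x : X) {f g : ofCompHaus X} (h : f ≤ g) : ev x f ≤ ev x g := h x

/-- The maximal ideal of the functions that vanish at `x`. -/
def vanishingIdeal (x : X) : (ofCompHaus X).YosidaSpace where
  val := LinearMap.ker (ev x)
  property :=
    { isIdeal := fun f g hg h => by
        have := ev_mono x h
        rw [ev_abs, ev_abs, LinearMap.mem_ker.mp hg, abs_zero] at this
        exact LinearMap.mem_ker.mpr (abs_nonpos_iff.mp this)
      unit_notMem := fun h => one_ne_zero (α := ℝ) h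
      eq_of_le := fun Q hQ hu hle => by
        refine le_antisymm (fun f hf => ?_) hle
        by_contra hfx
        have h1 : f - ev x f • (ofCompHaus X).unit ∈ Q :=
          hle (by rw [LinearMap.mem_ker, map_sub, map_smul, ev_unit, smul_eq_mul, mul_one, sub_self])
        have h2 := Q.sub_mem hf h1
        rw [sub_sub_cancel] at h2
        exact hu ((Q.smul_mem_iff hfx).mp h2) }

theorem value_vanishingIdeal (f : ofCompHaus X) (x : X) :
    value f (vanishingIdeal x) = ev x f :=
  value_eq (by
    change _ ∈ LinearMap.ker (ev x)
    rw [LinearMap.mem_ker, map_sub, map_smul, ev_unit, smul_eq_mul, mul_one, sub_self])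

/-- The continuous map `X → YA` dual to a morphism `A → C(X)`. -/
def dual (ι : Hom A (ofCompHaus X)) : C(X, A.Y) :=
  ι.Y.comp
    { toFun := fun x => (vanishingIdeal x : (ofCompHaus X).YosidaSpace)
      continuous_toFun := by
        refine continuous_generateFrom_iff.mpr ?_
        rintro _ ⟨f, rfl⟩
        change C(X, ℝ) at f
        exact isOpen_ne_fun f.continuous continuous_const }

theorem value_dual (ι : Hom A (ofCompHaus X)) (a : A) (x : X) :
    value (A := A) a (dual ι x) = ev x (ι a) :=
  (value_Y ι a _).trans (value_vanishingIdeal _ x)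

/-- The range is compact. If it missed `P`, an element with values 0 on the range and 1 at `P` would
be a nonzero element of the kernel of `ι`. -/
theorem dual_surjective {ι : Hom A (ofCompHaus X)} (hι : Function.Injective ι) :
    Function.Surjective (dual ι) := by
  intro P
  by_contra hP
  change A.YosidaSpace at P
  have hcl : IsClosed (Set.range (dual ι)) := (isCompact_range (dual ι).continuous).isClosed
  obtain ⟨a, ha0, ha1⟩ := exists_value_zero_one (A := A) hcl (isClosed_singleton (x := P))
    (Set.disjoint_singleton_right.mpr hP)
  have h0 : ι a = 0 := ofCompHaus_ext fun x =>
    (value_dual ι a x).symm.trans (ha0 _ ⟨x, rfl⟩)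
  have : a = 0 := hι (h0.trans (map_zero ι.toLin).symm)
  have h1 : value a P = 1 := ha1 P rfl
  rw [this, value_eq_zero.mpr (Submodule.zero_mem _)] at h1
  exact zero_ne_one h1

/-- The separation of points by a morphism into `C(X)`. -/
def Hom.Separates (ι : Hom A (ofCompHaus X)) : Prop :=
  ∀ x y : X, x ≠ y → ∃ a : A, ev x (ι a) ≠ ev y (ι a)

theorem dual_injective {ι : Hom A (ofCompHaus X)} (hι : ι.Separates) :
    Function.Injective (dual ι) := by
  intro x y hxy
  by_contra hne
  obtain ⟨a, ha⟩ := hι x y hne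
  exact ha (by rw [← value_dual, ← value_dual, hxy])

/-- The dual of a point-separating embedding is a homeomorphism. -/
noncomputable def dualHomeomorph (ι : Hom A (ofCompHaus X)) (hι : Function.Injective ι)
    (hs : ι.Separates) : X ≃ₜ A.Y :=
  (dual ι).continuous.homeoOfEquivCompactToT2
    (f := Equiv.ofBijective (dual ι) ⟨dual_injective hs, dual_surjective hι⟩)

theorem separates_of_surjective {ι : Hom A (ofCompHaus X)} (hι : Function.Surjective ι) :
    ι.Separates := by
  intro x y hne
  obtain ⟨f, -, hf⟩ := exists_continuous_eventually_const_ne x hne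
  obtain ⟨a, rfl⟩ := hι f
  exact ⟨a, hf⟩

/-! ### Injectivity, lifting and essential embeddings -/

theorem Y_surjective {φ : Hom A B} (hφ : Function.Injective φ) : Function.Surjective φ.Y := by
  have h : φ.Y = dual (B.nu.comp φ) := ContinuousMap.ext fun Q =>
    value_ext fun a => (value_Y φ a Q).trans (value_dual (B.nu.comp φ) a Q).symm
  rw [h]
  exact dual_surjective ((nu_injective B).comp hφ)

theorem injective_of_Y_surjective {φ : Hom A B} (hφ : Function.Surjective φ.Y) :
    Function.Injective φ := by
  intro a b hab
  refine nu_injective A (ofCompHaus_ext fun P => ?_)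
  obtain ⟨Q, rfl⟩ := hφ P
  exact (value_Y φ a Q).trans (hab ▸ (value_Y φ b Q).symm)

/-- A morphism factors through an embedding that contains its range. -/
theorem exists_lift {C : WStar.{u}} (α : Hom A C) {β : Hom B C} (hβ : Function.Injective β)
    (h : ∀ a, α a ∈ Set.range β) : ∃ f : Hom A B, β.comp f = α := by
  choose f hf using h
  refine ⟨⟨⟨⟨f, fun a b => hβ ?_⟩, fun r a => hβ ?_⟩, fun a b => hβ ?_, fun a b => hβ ?_,
    hβ ?_⟩, Hom.ext (LinearMap.ext hf)⟩
  · rw [map_add, hf, hf, hf, map_add]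
  · simp only [RingHom.id_apply]
    rw [map_smul, hf, hf, map_smul]
  · change β (f _) = β (f a ⊔ f b)
    rw [β.map_sup', hf, hf, hf, α.map_sup']
  · change β (f _) = β (f a ⊓ f b)
    rw [β.map_inf', hf, hf, hf, α.map_inf']
  · change β (f _) = _
    rw [hf, α.map_unit', β.map_unit']

theorem Hom.isIso_of_bijective {f : Hom A B} (hf : Function.Bijective f) : f.IsIso := by
  obtain ⟨g, hg⟩ := exists_lift (Hom.id B) hf.1 fun b => hf.2 b
  refine ⟨g, Hom.ext (LinearMap.ext fun a => hf.1 ?_), hg⟩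
  exact DFunLike.congr_fun (congrArg Hom.toLin hg) (f a)

theorem Hom.IsIso.bijective {f : Hom A B} (hf : f.IsIso) : Function.Bijective f := by
  obtain ⟨g, hgf, hfg⟩ := hf
  exact Function.bijective_iff_has_inverse.mpr ⟨g,
    fun a => DFunLike.congr_fun (congrArg Hom.toLin hgf) a,
    fun b => DFunLike.congr_fun (congrArg Hom.toLin hfg) b⟩

/-- An embedding whose dual map is a cover is essential. -/
theorem isEssentialEmbedding_of_isCover {f : Hom A B} (hf : IsCover f.Y) :
    f.IsEssentialEmbedding := by
  refine ⟨injective_of_Y_surjective hf.surjective, fun C f₁ hinj => ?_⟩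
  refine injective_of_Y_surjective (Set.range_eq_univ.mp ?_)
  by_contra hne
  -- The range of `f₁.Y` is closed and `f.Y` maps it onto `YA`, because `f₁ ∘ f` is injective;
  -- irreducibility leaves no room for it to be proper.
  refine hf.irreducible _ (isCompact_range f₁.Y.continuous).isClosed hne ?_
  rw [← Set.range_comp]
  exact (Y_surjective hinj).range_eq

end Dual

end WStar

namespace WStar

/-! ## Functions constant near a point -/

section ConstNear

variable {X : CompHaus.{u}}

/-- The vector lattice of the continuous functions on `X` that are constant near `p`. -/
def constNearSubmodule (p : X) : Submodule ℝ (ofCompHaus X) where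
  carrier := {f | ∀ᶠ x in nhds p, ev x f = ev p f}
  add_mem' hf hg := by
    filter_upwards [hf, hg] with x hx hy
    rw [map_add, map_add, hx, hy]
  zero_mem' := Filter.Eventually.of_forall fun x => by rw [map_zero, map_zero]
  smul_mem' r f hf := by
    filter_upwards [hf] with x hx
    rw [map_smul, map_smul, hx]

theorem mem_constNearSubmodule {p : X} {f : ofCompHaus X} :
    f ∈ constNearSubmodule p ↔ ∀ᶠ x in nhds p, ev x f = ev p f := Iff.rfl

theorem ev_sup (x : X) (f g : ofCompHaus X) : ev x (f ⊔ g) = ev x f ⊔ ev x g := rfl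

theorem ev_inf (x : X) (f g : ofCompHaus X) : ev x (f ⊓ g) = ev x f ⊓ ev x g := rfl

theorem sup_mem_constNearSubmodule {p : X} {f g : ofCompHaus X} (hf : f ∈ constNearSubmodule p)
    (hg : g ∈ constNearSubmodule p) : f ⊔ g ∈ constNearSubmodule p := by
  rw [mem_constNearSubmodule] at hf hg ⊢
  filter_upwards [hf, hg] with x hx hy
  rw [ev_sup, ev_sup, hx, hy]

theorem inf_mem_constNearSubmodule {p : X} {f g : ofCompHaus X} (hf : f ∈ constNearSubmodule p)
    (hg : g ∈ constNearSubmodule p) : f ⊓ g ∈ constNearSubmodule p := by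
  rw [mem_constNearSubmodule] at hf hg ⊢
  filter_upwards [hf, hg] with x hx hy
  rw [ev_inf, ev_inf, hx, hy]

instance (p : X) : Lattice (constNearSubmodule p) :=
  Subtype.lattice (fun _ _ => sup_mem_constNearSubmodule) (fun _ _ => inf_mem_constNearSubmodule)

instance (p : X) : IsOrderedModule ℝ (constNearSubmodule p) where
  smul_le_smul_of_nonneg_left r hr f g h :=
    show r • f.1 ≤ r • g.1 from smul_le_smul_of_nonneg_left (show f.1 ≤ g.1 from h) hr
  smul_le_smul_of_nonneg_right f hf r s h :=
    show r • f.1 ≤ s • f.1 from smul_le_smul_of_nonneg_right h (show 0 ≤ f.1 from hf)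

/-- The functions constant near `p`, as an object of `W*`. -/
def constNear (p : X) : WStar.{u} where
  carrier := constNearSubmodule p
  isOrderedAddMonoid :=
    { add_le_add_left := fun f g h k => add_le_add_left (show f.1 ≤ g.1 from h) k.1 }
  isOrderedModule := inferInstance
  archimedean f g h := (ofCompHaus X).archimedean f.1 g.1 h
  unit := ⟨(ofCompHaus X).unit, Filter.Eventually.of_forall fun _ => rfl⟩
  unit_nonneg := (ofCompHaus X).unit_nonneg
  exists_abs_le f := (ofCompHaus X).exists_abs_le f.1

/-- The inclusion of the functions constant near `p`. -/
def constNearIncl (p : X) : Hom (constNear p) (ofCompHaus X) where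
  toLin := (constNearSubmodule p).subtype
  map_sup' _ _ := rfl
  map_inf' _ _ := rfl
  map_unit' := rfl

theorem constNearIncl_injective (p : X) : Function.Injective (constNearIncl p) :=
  Subtype.val_injective

/-- Separation of points makes `X` the Yosida space of `constNear p`, for every choice of `p`. -/
theorem constNearIncl_separates (p : X) : (constNearIncl p).Separates := fun x y hxy => by
  obtain ⟨f, hf, hne⟩ := exists_continuous_eventually_const_ne p hxy
  exact ⟨⟨f, hf⟩, hne⟩

end ConstNear

/-! ## The classes `{A : μ(c)A = H}` and `{X : cX = YH}` -/

section Main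

variable {c : CoveringOperator.{u}} {H M : WStar.{u}}

theorem pullback_injective {X Y : CompHaus.{u}} {τ : C(Y, X)} (hτ : Function.Surjective τ) :
    Function.Injective (pullback τ) := fun f g hfg => ofCompHaus_ext fun x => by
  obtain ⟨y, rfl⟩ := hτ x
  exact congrArg (ev y) hfg

/-- The isomorphism `μ(c)_H` is `ν_H` followed by the injective pullback along the cover of `YH`, so
`ν_H` must already be onto. The equality `μ(c)H = H` enters the proof in this form. -/
theorem nu_surjective_of_mem_fix (hH : H ∈ (mu c).fix) : Function.Surjective H.nu := fun f => by
  obtain ⟨a, ha⟩ := (Hom.IsIso.bijective hH).2 (pullback (c.map H.Y) f)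
  exact ⟨a, pullback_injective (c.isCover H.Y).surjective ha⟩

/-- If `ν_H` is onto, continuous maps `YH → YA` come from morphisms `A → H`. -/
theorem exists_hom_of_map (hν : Function.Surjective H.nu) {A : WStar.{u}} {X : CompHaus.{u}}
    (f : C(H.Y, X)) (ι : Hom A (ofCompHaus X)) :
    ∃ ψ : Hom A H, H.nu.comp ψ = (pullback f).comp ι ∧ ψ.Y = (dual ι).comp f := by
  obtain ⟨ψ, hψ⟩ := exists_lift ((pullback f).comp ι) (nu_injective H) fun a => hν _
  refine ⟨ψ, hψ, ContinuousMap.ext fun Q => value_ext fun a => ?_⟩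
  refine (value_Y ψ a Q).trans (Eq.trans ?_ (value_dual ι a (f Q)).symm)
  exact congrArg (ev Q) (DFunLike.congr_fun (congrArg Hom.toLin hψ) a)

/-- Isomorphisms `e : H → C(cYA)` and homeomorphisms `h : YH → cYA` determine each other: `h` is the
inverse of the dual of `e`, and `e` is `ν_H` followed by composition with `h⁻¹`. -/
theorem memV_iff (hν : Function.Surjective H.nu) {A : WStar.{u}} (φ : Hom A H) :
    (mu c).MemV H A φ ↔ c.MemS H.Y A.Y φ.Y := by
  constructor
  · rintro ⟨e, he, hφ⟩
    have hb := he.bijective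
    refine ⟨(dualHomeomorph e hb.1 (separates_of_surjective hb.2)).symm, fun Q => ?_⟩
    obtain ⟨y, rfl⟩ := (dualHomeomorph e hb.1 (separates_of_surjective hb.2)).surjective Q
    rw [Homeomorph.symm_apply_apply]
    refine value_ext fun a => ?_
    refine Eq.trans ?_ ((value_Y φ a _).trans (value_dual e (φ a) y)).symm
    exact (congrArg (ev y) (DFunLike.congr_fun (congrArg Hom.toLin hφ) a)).symm
  · rintro ⟨h, hh⟩
    refine ⟨(pullback (h.symm : C(c.obj A.Y, H.Y))).comp H.nu, Hom.isIso_of_bijective ?_, ?_⟩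
    · refine ⟨(pullback_injective h.symm.surjective).comp (nu_injective H), fun f => ?_⟩
      obtain ⟨a, ha⟩ := hν (pullback (h : C(H.Y, c.obj A.Y)) f)
      refine ⟨a, ofCompHaus_ext fun y => ?_⟩
      change ev (h.symm y) (H.nu a) = ev y f
      rw [ha]
      change ev (h (h.symm y)) f = ev y f
      rw [h.apply_symm_apply]
    · refine Hom.ext (LinearMap.ext fun a => ofCompHaus_ext fun y => ?_)
      refine (value_Y φ a (h.symm y)).symm.trans ?_
      refine congrArg (value (A := A) a) ?_
      rw [← hh, h.apply_symm_apply]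

/-- A point-separating embedding `A → C(X)` of an object over a member `(X, f)` of
`{X : cX = YH}` gives a member of `{A : μ(c)A = H}`. -/
theorem exists_memV (hν : Function.Surjective H.nu) {A : WStar.{u}} {X : CompHaus.{u}}
    {f : C(H.Y, X)} (hf : c.MemS H.Y X f) {ι : Hom A (ofCompHaus X)} (hι : Function.Injective ι)
    (hs : ι.Separates) :
    ∃ ψ : Hom A H, (∀ a Q, value (ψ a) Q = ev (f Q) (ι a)) ∧ (mu c).MemV H A ψ := by
  obtain ⟨ψ, hψ, hY⟩ := exists_hom_of_map hν f ι
  refine ⟨ψ, fun a Q => congrArg (ev (X := H.Y) Q) (DFunLike.congr_fun (congrArg Hom.toLin hψ) a),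
    (memV_iff hν ψ).mpr ?_⟩
  rw [hY]
  exact hf.homeomorph_comp (dualHomeomorph ι hι hs)

/-! ### Comparing a minimum of V with chosen members, and the converse -/

/-- For `X` in S(YH, c) the test object is `C(X)`; the dual of the embedding `M → C(X)` is the
required map `X → YM`. -/
theorem isMinimumS_of_isMinimumV (hν : Function.Surjective H.nu) {φ : Hom M H}
    (h : (mu c).IsMinimumV H M φ) : c.IsMinimumS H.Y M.Y φ.Y := by
  refine ⟨(memV_iff hν φ).mp h.1, fun X f hf => ?_⟩
  obtain ⟨ψ, hψ, hV⟩ := exists_memV hν hf (ι := Hom.id (ofCompHaus X)) Function.injective_id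
    (separates_of_surjective Function.surjective_id)
  obtain ⟨k, -, rfl⟩ := h.2 _ ψ hV
  refine ⟨dual k, ContinuousMap.ext fun Q => value_ext fun m => ?_⟩
  refine (value_Y _ m Q).trans ?_
  exact (hψ (k m) Q).trans (value_dual k m (f Q)).symm

/-- The test object is `constNear p` over `YM` itself. Since `φ` factors through it and `YH → YM` is
onto, each `m` has the same values as a function constant near `p`; the point `p` is arbitrary. -/
theorem isLocallyConstant_value_of_isMinimumV (hν : Function.Surjective H.nu) {φ : Hom M H}
    (h : (mu c).IsMinimumV H M φ) (m : M) : IsLocallyConstant (value m) := by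
  have hS := (memV_iff hν φ).mp h.1
  refine (IsLocallyConstant.iff_eventually_eq _).mpr fun p => ?_
  obtain ⟨ψ, hψ, hV⟩ := exists_memV hν hS (constNearIncl_injective (X := M.Y) p)
    (constNearIncl_separates (X := M.Y) p)
  obtain ⟨k, -, rfl⟩ := h.2 _ ψ hV
  have hk (P : M.YosidaSpace) : value m P = ev (X := M.Y) P (constNearIncl (X := M.Y) p (k m)) := by
    obtain ⟨Q, rfl⟩ := hS.isCover.surjective P
    exact (value_Y _ m Q).trans (hψ (k m) Q)
  simp only [hk]
  exact (k m).2

theorem isZeroDimensional_of_isLocallyConstant (h : ∀ m : M, IsLocallyConstant (value m)) :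
    IsZeroDimensional M.Y := by
  refine TopologicalSpace.isTopologicalBasis_of_isOpen_of_nhds (fun U hU => hU.isOpen)
    fun P U hP hU => ?_
  change M.YosidaSpace at P
  change Set M.YosidaSpace at U
  obtain ⟨a, ha0, ha1⟩ := exists_value_zero_one (A := M) (F := Uᶜ) hU.isClosed_compl
    (isClosed_singleton (x := P)) (Set.disjoint_singleton_right.mpr fun h => h hP)
  refine ⟨value a ⁻¹' {1}, (h a).isClopen_fiber 1, ha1 P rfl, fun Q hQ => ?_⟩
  by_contra hQU
  exact zero_ne_one ((ha0 Q hQU).symm.trans hQ)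

/-- Composition with `g : YA → YM` preserves finite range, so it carries `M` into the copy of
`F(YA)` inside `A`. The resulting `f` has dual `g`, a cover because `Yφ = g ∘ Yψ` is one. -/
theorem isMinimumV_of_isMinimumS (hν : Function.Surjective H.nu) {φ : Hom M H}
    (h : c.IsMinimumS H.Y M.Y φ.Y) (hM : Set.range M.nu = finiteRange M.Y) :
    (mu c).IsMinimumV H M φ := by
  refine ⟨(memV_iff hν φ).mpr h.1, fun A ψ hψ => ?_⟩
  have hψS := (memV_iff hν ψ).mp hψ
  obtain ⟨g, hg⟩ := h.2 _ _ hψS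
  obtain ⟨f, hf⟩ := exists_lift ((pullback g).comp M.nu) (nu_injective A) fun m => by
    refine finiteRange_subset_range_nu A ?_
    have hm : M.nu m ∈ finiteRange M.Y := hM ▸ ⟨m, rfl⟩
    exact Set.Finite.subset hm (Set.range_comp_subset_range g (value m))
  have hval (m : M) (P : A.Y) : value (A := A) (f m) P = value (A := M) m (g P) :=
    congrArg (ev P) (DFunLike.congr_fun (congrArg Hom.toLin hf) m)
  have hfY : f.Y = g := ContinuousMap.ext fun P => value_ext fun m =>
    (value_Y f m P).trans (hval m P)
  refine ⟨f, isEssentialEmbedding_of_isCover ?_, ?_⟩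
  · rw [hfY]
    have hφc := h.1.isCover
    rw [hg] at hφc
    exact hφc.of_comp hψS.isCover.surjective
  · refine Hom.ext (LinearMap.ext fun m => nu_injective H (ofCompHaus_ext fun Q => ?_))
    refine (value_Y φ m Q).symm.trans (Eq.trans ?_ (value_Y ψ (f m) Q))
    rw [hval, hg]
    rfl

end Main

end WStar

theorem mainTheorem6 (c : CoveringOperator.{u}) (H : WStar.{u}) (hH : H ∈ (WStar.mu c).fix)
    (M : WStar.{u}) :
    (∀ φ : WStar.Hom M H,
      (WStar.mu c).IsMinimumV H M φ ↔
        c.IsMinimumS H.Y M.Y φ.Y ∧ IsZeroDimensional M.Y ∧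
          Set.range M.nu = WStar.finiteRange M.Y) ∧
    ((∃ φ : WStar.Hom M H, (WStar.mu c).IsMinimumV H M φ) ↔
      (∃ f : C(H.Y, M.Y), c.IsMinimumS H.Y M.Y f) ∧ IsZeroDimensional M.Y ∧
        Set.range M.nu = WStar.finiteRange M.Y) := by
  have hν := WStar.nu_surjective_of_mem_fix hH
  have main (φ : WStar.Hom M H) : (WStar.mu c).IsMinimumV H M φ ↔
      c.IsMinimumS H.Y M.Y φ.Y ∧ IsZeroDimensional M.Y ∧
        Set.range M.nu = WStar.finiteRange M.Y := by
    refine ⟨fun h => ?_, fun h => WStar.isMinimumV_of_isMinimumS hν h.1 h.2.2⟩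
    have hlc := WStar.isLocallyConstant_value_of_isMinimumV hν h
    refine ⟨WStar.isMinimumS_of_isMinimumV hν h, WStar.isZeroDimensional_of_isLocallyConstant hlc,
      Set.Subset.antisymm ?_ (WStar.finiteRange_subset_range_nu M)⟩
    rintro _ ⟨m, rfl⟩
    -- Compactness of `YM` turns local constancy into finite range.
    exact (hlc m).range_finite
  refine ⟨main, fun ⟨φ, hφ⟩ => ?_, fun ⟨⟨f, hf⟩, hz, hM⟩ => ?_⟩
  · obtain ⟨hS, hz, hM⟩ := (main φ).mp hφ
    exact ⟨⟨φ.Y, hS⟩, hz, hM⟩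
  -- As `ν_H` is onto and the dual of `ν_M` is the identity of `YM`, every continuous `f : YH → YM`
  -- is `Yφ` for some `φ`; this reduces the second claim to the first.
  · obtain ⟨φ, -, hφ⟩ := WStar.exists_hom_of_map hν f M.nu
    have hd (P : M.Y) : WStar.dual M.nu P = P :=
      WStar.value_ext fun a => WStar.value_dual M.nu a P
    have hφf : φ.Y = f := hφ.trans (ContinuousMap.ext fun Q => hd (f Q))
    exact ⟨φ, (main φ).mpr ⟨hφf ▸ hf, hz, hM⟩⟩
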